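/- An affine plane $\mathcal A=(\mathcal P,\mathcal L)$ consists of a set $\mathcal P$ of points and a set $\mathcal L$ of subsets of $\mathcal P$ (lines) such that two distinct points lie on exactly one line, for every line $\ell$ and every point $p\notin\ell$ there is exactly one line through $p$ disjoint from $\ell$, and there are three distinct non-collinear points. Two lines are parallel if they are equal or disjoint, and $\ell^{PQ}$ is the line through $P\ne Q$. $\mathcal A$ is a Desargues affine plane if the following holds: whenever $k,l,m$ are distinct lines that are either parallel to one another or pass through a common point $Z$, and $A,A'\in k$, $B,B'\in l$, $C,C'\in m$ are points (all different from $Z$ in the second case) with $\ell^{AB}\parallel \ell^{A'B'}$ and $\ell^{BC}\parallel \ell^{B'C'}$, then $\ell^{AC}\parallel \ell^{A'C'}$. $\mathcal A$ satisfies Pappus' condition if, for any two distinct lines $g,h$, any distinct points $A,C,E\in g\setminus h$ and any distinct points $B,F,D\in h\setminus g$: (i) if $n$ is a line such that $\ell^{CB},\ell^{EF}$ meet in a point of $n$ and $\ell^{AF},\ell^{CD}$ meet in a point of $n$, then $\ell^{AB},\ell^{ED}$ meet in a point of $n$ or are both parallel to $n$; (ii) if $\ell^{CB}\parallel\ell^{EF}$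 and $\ell^{AF}\parallel\ell^{CD}$, then $\ell^{AB}\parallel\ell^{ED}$. An ordered line is a line $\ell$ with a ternary relation $[A,B,C]$ ("$B$ is between $A$ and $C$") on its points such that: $[A,B,C]$ implies $[C,B,A]$; for distinct $A,B,C\in\ell$ exactly one of $[A,B,C]$, $[B,C,A]$, $[C,A,B]$ holds; for distinct $A,B,C,D\in\ell$, $[A,B,C]$ and $[B,C,D]$ imply $[A,B,D]$ and $[A,C,D]$; for distinct $A,B,C,D\in\ell$, $[A,B,C]$ and $[C,B,D]$ imply $[D,A,B]$ or $[A,D,B]$. Let $\ell$ be a line with distinct points $O,I$. For $A,C\in\ell$ and a point $B\notin\ell$, define $A+C$ as the point where $\ell$ meets the parallel to $\ell^{CB}$ through $D$, where $D$ is the intersection of the parallel to $\ell$ through $B$ and the parallel to $\ell^{OB}$ through $A$; and define $A*C$ as the point where $\ell$ meets the parallel to $\ell^{BC}$ through $E$, where $E$ is the intersection of $\ell^{OB}$ and the parallel to $\ell^{IB}$ through $A$. A skew field constructed over $\ell$ is a skew field $(\ell,+,*)$ with zero $O$ and unit $I$ whose operations are these, for every choice of $B\notin\ell$. A skew field $K$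 is called Pappian if the affine plane $K\times K$ (with lines $\{p+tv: t\in K\}$, $v\neq 0$) satisfies Pappus' condition. **Theorem.** Let $\mathcal A$ be a finite Desargues affine plane (for example one whose points are points of $\mathbb R^2$; no embedding into $\mathbb R^2$ is needed), let $\ell$ be an ordered line of $\mathcal A$ and let $O\ne I$ be points of $\ell$. Then the construction above makes $\ell$ a (finite) skew field, every skew field so constructed over $\ell$ is Pappian and commutative, and the plane $\mathcal A$ itself satisfies Pappus' condition. -/

import Mathlib

/-- An affine plane on the set of points `P`; a line is a set of points. -/
structure AffinePlane (P : Type*) where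
  lines : Set (Set P)
  existsUnique_line : ∀ p q : P, p ≠ q → ∃! l : Set P, l ∈ lines ∧ p ∈ l ∧ q ∈ l
  playfair : ∀ (p : P), ∀ l ∈ lines, p ∉ l → ∃! m : Set P, m ∈ lines ∧ p ∈ m ∧ l ∩ m = ∅
  exists_noncollinear : ∃ p q r : P, p ≠ q ∧ p ≠ r ∧ q ≠ r ∧
    ∀ l ∈ lines, ¬ (p ∈ l ∧ q ∈ l ∧ r ∈ l)

namespace AffinePlane

variable {P : Type*}

/-- Two lines are parallel if they are equal or have no point in common. -/
def Parallel (l m : Set P) : Prop := l = m ∨ l ∩ m = ∅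

/-- The line through two distinct points `p` and `q`. -/
def join (S : AffinePlane P) (p q : P) : Set P :=
  {r | ∃ l ∈ S.lines, p ∈ l ∧ q ∈ l ∧ r ∈ l}

/-- The line through the point `p` parallel to the line `l`. -/
def parallelThrough (S : AffinePlane P) (p : P) (l : Set P) : Set P :=
  {r | ∃ m ∈ S.lines, Parallel m l ∧ p ∈ m ∧ r ∈ m}

/-- Desargues' axiom: if the vertices of the triangles `A B C`, `A' B' C'` lie on three distinct
lines which are parallel, or which pass through a common point distinct from the six vertices,
and two pairs of corresponding sides are parallel, then so is the third pair. -/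
def IsDesargues (S : AffinePlane P) : Prop :=
  ∀ k ∈ S.lines, ∀ l ∈ S.lines, ∀ m ∈ S.lines, k ≠ l → l ≠ m → k ≠ m →
    ∀ A ∈ k, ∀ A' ∈ k, ∀ B ∈ l, ∀ B' ∈ l, ∀ C ∈ m, ∀ C' ∈ m,
      ((Parallel k l ∧ Parallel l m ∧ Parallel k m) ∨
        ∃ Z, Z ∈ k ∧ Z ∈ l ∧ Z ∈ m ∧
          A ≠ Z ∧ A' ≠ Z ∧ B ≠ Z ∧ B' ≠ Z ∧ C ≠ Z ∧ C' ≠ Z) →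
      Parallel (S.join A B) (S.join A' B') →
      Parallel (S.join B C) (S.join B' C') →
      Parallel (S.join A C) (S.join A' C')

/-- Pappus' condition. Let `A, C, E` be distinct points of a line `g` and `B, F, D` distinct points
of another line `h`, none of them on both lines. If `CB ∩ EF` and `AF ∩ CD` lie on a line `n`, then
so does `AB ∩ ED`, where parallel lines `AB`, `ED` are regarded as meeting on `n` when they are
parallel to `n`. If `CB`, `EF` are parallel and `AF`, `CD` are parallel, then so are `AB`, `ED`
(the same statement with the line at infinity as `n`). -/
def IsPappian (S : AffinePlane P) : Prop :=
  ∀ g ∈ S.lines, ∀ h ∈ S.lines, g ≠ h →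
    ∀ A ∈ g, ∀ C ∈ g, ∀ E ∈ g, ∀ B ∈ h, ∀ F ∈ h, ∀ D ∈ h,
      A ∉ h → C ∉ h → E ∉ h → B ∉ g → F ∉ g → D ∉ g →
      A ≠ C → A ≠ E → C ≠ E → B ≠ F → B ≠ D → F ≠ D →
      (∀ n ∈ S.lines,
        (∃ N ∈ n, N ∈ S.join C B ∧ N ∈ S.join E F) →
        (∃ M ∈ n, M ∈ S.join A F ∧ M ∈ S.join C D) →
        (∃ L ∈ n, L ∈ S.join A B ∧ L ∈ S.join E D) ∨
          (Parallel (S.join A B) n ∧ Parallel (S.join E D) n)) ∧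
      (Parallel (S.join C B) (S.join E F) → Parallel (S.join A F) (S.join C D) →
        Parallel (S.join A B) (S.join E D))

/-- `E = A + C` on the line `l` with zero `O`, by the construction with auxiliary point `B`. -/
def IsPointSum (S : AffinePlane P) (l : Set P) (O B A C E : P) : Prop :=
  ∃ D : P, S.parallelThrough B l ∩ S.parallelThrough A (S.join O B) = {D} ∧
    S.parallelThrough D (S.join C B) ∩ l = {E}

/-- `F = A * C` on the line `l` with zero `O` and unit `I`, by the construction with auxiliary
point `B`. -/
def IsPointProd (S : AffinePlane P) (l : Set P) (O I B A C F : P) : Prop :=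
  ∃ E : P, S.parallelThrough A (S.join I B) ∩ S.join O B = {E} ∧
    S.parallelThrough E (S.join B C) ∩ l = {F}

/-- The division ring structure `K` on the points of the line `l` is the skew field constructed
over `l` with zero `O` and unit `I`: its sums and products are given by the geometric
constructions, with any auxiliary point `B` off the line. -/
def IsSkewFieldOver (S : AffinePlane P) (l : Set P) (O I : l) (K : DivisionRing l) : Prop :=
  K.zero = O ∧ K.one = I ∧
    ∀ A C : l, ∀ B : P, B ∉ l →
      S.IsPointSum l O B A C (K.add A C : l) ∧ S.IsPointProd l O I B A C (K.mul A C : l)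

end AffinePlane

/-- A betweenness relation (`btw A B C` means that `B` lies between `A` and `C`) making a line into
an ordered line. -/
structure IsOrderedLine {α : Type*} (btw : α → α → α → Prop) : Prop where
  lo1 : ∀ A B C, btw A B C → btw C B A
  lo2 : ∀ A B C, A ≠ B → B ≠ C → A ≠ C →
    (btw A B C ∨ btw B C A ∨ btw C A B) ∧
      ¬ (btw A B C ∧ btw B C A) ∧ ¬ (btw A B C ∧ btw C A B) ∧ ¬ (btw B C A ∧ btw C A B)
  lo3 : ∀ A B C D, A ≠ B → A ≠ C → A ≠ D → B ≠ C → B ≠ D → C ≠ D →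
    btw A B C → btw B C D → btw A B D ∧ btw A C D
  lo4 : ∀ A B C D, A ≠ B → A ≠ C → A ≠ D → B ≠ C → B ≠ D → C ≠ D →
    btw A B C → btw C B D → btw D A B ∨ btw A D B

/-- The line `p + K v` in the left vector space `K × K`. -/
def coordLine {K : Type*} [DivisionRing K] (p v : K × K) : Set (K × K) :=
  {q | ∃ t : K, q = p + t • v}

theorem coordLine_rebase {K : Type*} [DivisionRing K] {p v q : K × K} (hq : q ∈ coordLine p v) :
    coordLine p v = coordLine q v := by
  obtain ⟨s, rfl⟩ := hq
  ext r
  constructor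
  · rintro ⟨t, rfl⟩
    exact ⟨t - s, by rw [sub_smul]; abel⟩
  · rintro ⟨t, rfl⟩
    exact ⟨s + t, by rw [add_smul]; abel⟩

theorem coordLine_smul {K : Type*} [DivisionRing K] (p v : K × K) {c : K} (hc : c ≠ 0) :
    coordLine p (c • v) = coordLine p v := by
  ext r
  constructor
  · rintro ⟨t, rfl⟩
    exact ⟨t * c, by rw [mul_smul]⟩
  · rintro ⟨t, rfl⟩
    exact ⟨t * c⁻¹, by rw [smul_smul, mul_assoc, inv_mul_cancel₀ hc, mul_one]⟩

/-- The affine plane over a division ring `K`. -/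
def coordPlane (K : Type*) [DivisionRing K] : AffinePlane (K × K) where
  lines := {l | ∃ p v : K × K, v ≠ 0 ∧ l = coordLine p v}
  existsUnique_line := by
    intro p q hpq
    refine ⟨coordLine p (q - p), ⟨⟨p, q - p, sub_ne_zero.2 hpq.symm, rfl⟩, ⟨0, by simp⟩,
      ⟨1, by simp⟩⟩, ?_⟩
    rintro l ⟨⟨a, v, hv, rfl⟩, hp, hq⟩
    rw [coordLine_rebase hp] at hq ⊢
    obtain ⟨t, rfl⟩ := hq
    have ht : t ≠ 0 := by
      rintro rfl
      simp at hpq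
    rw [add_sub_cancel_left, coordLine_smul p v ht]
  playfair := by
    rintro p l ⟨a, v, hv, rfl⟩ hp
    refine ⟨coordLine p v, ⟨⟨p, v, hv, rfl⟩, ⟨0, by simp⟩, ?_⟩, ?_⟩
    · ext r
      simp only [Set.mem_inter_iff, Set.mem_empty_iff_false, iff_false, not_and]
      intro h1 h2
      apply hp
      rw [coordLine_rebase h1, ← coordLine_rebase h2]
      exact ⟨0, by simp⟩
    · rintro m ⟨⟨b, w, hw, rfl⟩, hpm, hdisj⟩
      rw [coordLine_rebase hpm] at hdisj ⊢
      by_cases hli : LinearIndependent K ![v, w]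
      · exfalso
        have htop := hli.span_eq_top_of_card_eq_finrank (by simp)
        have hmem : p - a ∈ Submodule.span K (Set.range ![v, w]) := by rw [htop]; trivial
        rw [Matrix.range_cons, Matrix.range_cons, Matrix.range_empty, Set.union_empty,
          Set.singleton_union, Submodule.mem_span_pair] at hmem
        obtain ⟨x, y, hxy⟩ := hmem
        have : a + x • v ∈ coordLine a v ∩ coordLine p w := by
          refine ⟨⟨x, rfl⟩, ⟨-y, ?_⟩⟩
          have : p = a + (x • v + y • w) := by rw [hxy]; abel
          rw [this, neg_smul]; abel
        rw [hdisj] at this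
        exact this
      · rw [LinearIndependent.pair_iff' hv] at hli
        push Not at hli
        obtain ⟨c, rfl⟩ := hli
        have hc : c ≠ 0 := by
          rintro rfl
          simp at hw
        exact coordLine_smul p v hc
  exists_noncollinear := by
    refine ⟨(0, 0), (1, 0), (0, 1), by simp, by simp, by simp, ?_⟩
    rintro l ⟨p, v, hv, rfl⟩ ⟨h0, h1, h2⟩
    rw [coordLine_rebase h0] at h1 h2
    obtain ⟨s, hs⟩ := h1
    obtain ⟨t, ht⟩ := h2
    simp only [Prod.ext_iff, Prod.fst_add, Prod.snd_add, Prod.smul_fst, Prod.smul_snd,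
      smul_eq_mul, zero_add] at hs ht
    have hs0 : s ≠ 0 := by
      rintro rfl
      simp at hs
    have hv2 : v.2 = 0 := by
      rcases mul_eq_zero.1 hs.2.symm with h | h
      · exact absurd h hs0
      · exact h
    rw [hv2, mul_zero] at ht
    exact one_ne_zero ht.2

/-- A skew field is Pappian if Pappus' condition holds in the affine plane over it. -/
def IsPappianSkewField {F : Type*} (K : DivisionRing F) : Prop :=
  (@coordPlane F K).IsPappian

namespace AffinePlane

variable {P : Type*} {S : AffinePlane P}

/-! ### Incidence and parallelism -/

/-! Desargues' axiom supplies dilatations, that is, maps sending each line into a parallel one. It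
says that moving points by perspectivity along a pencil of lines is consistent
(`IsPencil.exists_isDil`). Parallel pencils yield a translation taking any point to any other;
central pencils yield a homothety with given centre taking one point to another on the same line
through the centre.

Translations are determined by one value and, in a finite plane, closed under composition, so the
points become an abelian group with zero `O`. The endomorphisms preserving every line through zero
form a ring without zero divisors. Being finite, it is a field `K` by Wedderburn's little theorem.
Since homotheties are such endomorphisms, `K` acts transitively on the nonzero points of each line
through zero, and the lines are exactly the sets `p + K v` (`IsDesargues.exists_isVectorPlane`).

Over a field, coordinates adapted to the two given lines turn Pappus' condition into polynomial
identities valid because `K` is commutative (`IsVectorPlane.isPappian`). The map `t ↦ t • I` carries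
`K` onto `l`, and the geometric sum and product are computed by vectors. Finally, any division ring
on the finite set `l` is commutative, again by Wedderburn, so its coordinate plane is covered by the
same computation. -/

theorem line_unique {k m : Set P} (hk : k ∈ S.lines) (hm : m ∈ S.lines) {p q : P} (hpq : p ≠ q)
    (hpk : p ∈ k) (hqk : q ∈ k) (hpm : p ∈ m) (hqm : q ∈ m) : k = m :=
  (S.existsUnique_line p q hpq).unique ⟨hk, hpk, hqk⟩ ⟨hm, hpm, hqm⟩

theorem join_eq {m : Set P} (hm : m ∈ S.lines) {p q : P} (hpq : p ≠ q) (hp : p ∈ m) (hq : q ∈ m) :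
    S.join p q = m := by
  ext r
  constructor
  · rintro ⟨k, hk, hpk, hqk, hr⟩
    rwa [line_unique hm hk hpq hp hq hpk hqk]
  · exact fun hr => ⟨m, hm, hp, hq, hr⟩

theorem join_mem_lines {p q : P} (hpq : p ≠ q) : S.join p q ∈ S.lines := by
  obtain ⟨m, ⟨hm, hp, hq⟩, -⟩ := S.existsUnique_line p q hpq
  rwa [join_eq hm hpq hp hq]

theorem left_mem_join {p q : P} (hpq : p ≠ q) : p ∈ S.join p q := by
  obtain ⟨m, ⟨hm, hp, hq⟩, -⟩ := S.existsUnique_line p q hpq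
  exact ⟨m, hm, hp, hq, hp⟩

theorem right_mem_join {p q : P} (hpq : p ≠ q) : q ∈ S.join p q := by
  obtain ⟨m, ⟨hm, hp, hq⟩, -⟩ := S.existsUnique_line p q hpq
  exact ⟨m, hm, hp, hq, hq⟩

theorem join_comm (p q : P) : S.join p q = S.join q p := by
  ext r
  exact ⟨fun ⟨k, hk, hp, hq, hr⟩ => ⟨k, hk, hq, hp, hr⟩, fun ⟨k, hk, hp, hq, hr⟩ => ⟨k, hk, hq, hp, hr⟩⟩

theorem Parallel.refl (k : Set P) : Parallel k k := Or.inl rfl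

theorem Parallel.symm {k m : Set P} (h : Parallel k m) : Parallel m k := by
  rcases h with h | h
  · exact Or.inl h.symm
  · exact Or.inr (by rwa [Set.inter_comm])

theorem Parallel.eq_of_mem {k m : Set P} (h : Parallel k m) {p : P} (hk : p ∈ k) (hm : p ∈ m) :
    k = m := by
  rcases h with h | h
  · exact h
  · exact absurd (show p ∈ k ∩ m from ⟨hk, hm⟩) (by simp [h])

theorem parallel_of_forall {k m : Set P} (h : ∀ p ∈ k, p ∈ m → k = m) : Parallel k m := by
  by_cases hkm : k = m
  · exact Or.inl hkm
  · exact Or.inr (Set.eq_empty_iff_forall_notMem.2 fun p hp => hkm (h p hp.1 hp.2))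

theorem Parallel.trans {k m n : Set P} (hk : k ∈ S.lines) (hm : m ∈ S.lines) (hn : n ∈ S.lines)
    (h : Parallel k m) (h' : Parallel m n) : Parallel k n := by
  refine parallel_of_forall fun p hpk hpn => ?_
  by_cases hpm : p ∈ m
  · rw [h.eq_of_mem hpk hpm, h'.eq_of_mem hpm hpn]
  · have e1 : m ∩ k = ∅ := by
      rcases h.symm with h | h
      · exact absurd (h ▸ hpk) hpm
      · exact h
    have e2 : m ∩ n = ∅ := by
      rcases h' with h | h
      · exact absurd (h ▸ hpn) hpm
      · exact h
    exact (S.playfair p m hm hpm).unique ⟨hk, hpk, e1⟩ ⟨hn, hpn, e2⟩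

theorem exists_parallel (p : P) {m : Set P} (hm : m ∈ S.lines) :
    ∃ k ∈ S.lines, p ∈ k ∧ Parallel k m := by
  by_cases hp : p ∈ m
  · exact ⟨m, hm, hp, Parallel.refl m⟩
  · obtain ⟨k, ⟨hk, hpk, h⟩, -⟩ := S.playfair p m hm hp
    exact ⟨k, hk, hpk, Or.inr (by rwa [Set.inter_comm])⟩

theorem parallel_unique {k k' m : Set P} (hk : k ∈ S.lines) (hk' : k' ∈ S.lines) (hm : m ∈ S.lines)
    {p : P} (hp : p ∈ k) (hp' : p ∈ k') (h : Parallel k m) (h' : Parallel k' m) : k = k' :=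
  (h.trans hk hm hk' h'.symm).eq_of_mem hp hp'

theorem parallelThrough_eq {k m : Set P} (hk : k ∈ S.lines) (hm : m ∈ S.lines) {p : P} (hp : p ∈ k)
    (h : Parallel k m) : S.parallelThrough p m = k := by
  ext r
  constructor
  · rintro ⟨n, hn, hnm, hpn, hr⟩
    rwa [parallel_unique hk hn hm hp hpn h hnm]
  · exact fun hr => ⟨k, hk, h, hp, hr⟩

theorem exists_mem_of_not_parallel {k m : Set P} (h : ¬ Parallel k m) : ∃ p ∈ k, p ∈ m := by
  by_contra! hc
  exact h (parallel_of_forall fun p hk hm => absurd hm (hc p hk))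

theorem exists_notMem {m : Set P} (hm : m ∈ S.lines) : ∃ p, p ∉ m := by
  obtain ⟨p, q, r, -, -, -, h⟩ := S.exists_noncollinear
  by_contra! hc
  exact h m hm ⟨hc p, hc q, hc r⟩

/-- The axioms do not directly say that a line has two points. Two distinct parallel lines that are
not parallel to `m` cut it in different points, and two sides of a noncollinear triple cannot both
be parallel to `m`. -/
theorem exists_ne_mem {m : Set P} (hm : m ∈ S.lines) : ∃ p ∈ m, ∃ q ∈ m, p ≠ q := by
  obtain ⟨p, q, r, hpq, hpr, -, h⟩ := S.exists_noncollinear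
  have key : ∀ k ∈ S.lines, ∀ s, s ∉ k → ¬ Parallel k m → ∃ p ∈ m, ∃ q ∈ m, p ≠ q := by
    intro k hk s hs hkm
    obtain ⟨n, hn, hsn, hnk⟩ := exists_parallel (S := S) s hk
    obtain ⟨x, hxk, hxm⟩ := exists_mem_of_not_parallel hkm
    obtain ⟨y, hyn, hym⟩ := exists_mem_of_not_parallel
      (fun h => hkm (hnk.symm.trans hk hn hm h))
    refine ⟨x, hxm, y, hym, ?_⟩
    rintro rfl
    exact hs (hnk.eq_of_mem hyn hxk ▸ hsn)
  by_cases h1 : Parallel (S.join p q) m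
  · refine key _ (join_mem_lines hpr) q (fun hq => h _ (join_mem_lines hpr)
      ⟨left_mem_join hpr, hq, right_mem_join hpr⟩) fun h2 => ?_
    have := (h1.trans (join_mem_lines hpq) hm (join_mem_lines hpr) h2.symm).eq_of_mem
      (left_mem_join hpq) (left_mem_join hpr)
    exact h _ (join_mem_lines hpq) ⟨left_mem_join hpq, right_mem_join hpq,
      this ▸ right_mem_join hpr⟩
  · exact key _ (join_mem_lines hpq) r (fun hr => h _ (join_mem_lines hpq)
      ⟨left_mem_join hpq, right_mem_join hpq, hr⟩) h1

theorem exists_line (p q : P) : ∃ m ∈ S.lines, p ∈ m ∧ q ∈ m := by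
  by_cases hpq : p = q
  · obtain ⟨a, b, c, hab, -, -, -⟩ := S.exists_noncollinear
    obtain ⟨m, hm, hp, -⟩ := exists_parallel (S := S) p (join_mem_lines hab)
    exact ⟨m, hm, hp, hpq ▸ hp⟩
  · exact ⟨_, join_mem_lines hpq, left_mem_join hpq, right_mem_join hpq⟩

/-! ### Dilatations -/

/-- A dilatation (possibly constant) maps every line into a parallel line. -/
def IsDil (S : AffinePlane P) (f : P → P) : Prop :=
  ∀ m ∈ S.lines, ∀ x ∈ m, ∀ y ∈ m, ∃ m' ∈ S.lines, Parallel m' m ∧ f x ∈ m' ∧ f y ∈ m'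

theorem isDil_id : S.IsDil id := fun m hm _ hx _ hy => ⟨m, hm, Parallel.refl m, hx, hy⟩

theorem isDil_const (c : P) : S.IsDil fun _ => c := fun m hm _ _ _ _ => by
  obtain ⟨k, hk, hc, h⟩ := exists_parallel (S := S) c hm
  exact ⟨k, hk, h, hc, hc⟩

theorem IsDil.comp {f g : P → P} (hf : S.IsDil f) (hg : S.IsDil g) : S.IsDil (f ∘ g) := by
  intro m hm x hx y hy
  obtain ⟨k, hk, hkm, h1, h2⟩ := hg m hm x hx y hy
  obtain ⟨n, hn, hnk, h3, h4⟩ := hf k hk _ h1 _ h2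
  exact ⟨n, hn, hnk.trans hn hk hm hkm, h3, h4⟩

theorem IsDil.mem {f : P → P} (hf : S.IsDil f) {m k : Set P} (hm : m ∈ S.lines) (hk : k ∈ S.lines)
    (hkm : Parallel k m) {x y : P} (hx : x ∈ m) (hy : y ∈ m) (hfx : f x ∈ k) : f y ∈ k := by
  obtain ⟨n, hn, hnm, h1, h2⟩ := hf m hm x hx y hy
  rwa [parallel_unique hk hn hm hfx h1 hkm hnm]

/-- The image of `r` lies on the parallels to `pr` and `qr` through the known images of `p` and `q`.
These are not parallel to each other, so they meet only once. -/
theorem IsDil.eq_of_notMem {f g : P → P} (hf : S.IsDil f) (hg : S.IsDil g) {p q r : P}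
    (hp : f p = g p) (hq : f q = g q) {m : Set P} (hm : m ∈ S.lines) (hpm : p ∈ m) (hqm : q ∈ m)
    (hpq : p ≠ q) (hr : r ∉ m) : f r = g r := by
  obtain ⟨a, ha, hpa, hra⟩ := exists_line (S := S) p r
  obtain ⟨b, hb, hqb, hrb⟩ := exists_line (S := S) q r
  obtain ⟨a', ha', haa, h1, h2⟩ := hf a ha p hpa r hra
  obtain ⟨b', hb', hbb, h3, h4⟩ := hf b hb q hqb r hrb
  have h5 : g r ∈ a' := hg.mem ha ha' haa hpa hra (hp ▸ h1)
  have h6 : g r ∈ b' := hg.mem hb hb' hbb hqb hrb (hq ▸ h3)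
  by_contra hne
  have hab := line_unique ha' hb' hne h2 h5 h4 h6
  subst hab
  have := (haa.symm.trans ha ha' hb hbb).eq_of_mem hra hrb
  subst this
  exact hr (line_unique ha hm hpq hpa hqb hpm hqm ▸ hra)

theorem IsDil.eq {f g : P → P} (hf : S.IsDil f) (hg : S.IsDil g) {p q : P}
    (hp : f p = g p) (hq : f q = g q) (hpq : p ≠ q) : f = g := by
  obtain ⟨m, hm, hpm, hqm⟩ := exists_line (S := S) p q
  obtain ⟨s, hs⟩ := exists_notMem hm
  have hfs := hf.eq_of_notMem hg hp hq hm hpm hqm hpq hs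
  ext r
  by_cases hr : r ∈ m
  · by_cases hrp : r = p
    · rw [hrp, hp]
    -- Points of the line `pq` are reached from `p` and the auxiliary point `s` off that line.
    obtain ⟨k, hk, hpk, hsk⟩ := exists_line (S := S) p s
    refine hf.eq_of_notMem hg hp hfs hk hpk hsk (by rintro rfl; exact hs hpm) fun hrk => hs ?_
    exact line_unique hk hm hrp hrk hpk hr hpm ▸ hsk
  · exact hf.eq_of_notMem hg hp hq hm hpm hqm hpq hr

theorem IsDil.injective {f : P → P} (hf : S.IsDil f) {p q : P} (h : f p ≠ f q) :
    Function.Injective f := by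
  intro x y hxy
  by_contra hne
  -- A dilatation taking a value twice agrees at two points with a constant dilatation.
  have := hf.eq (isDil_const (f x)) rfl hxy.symm hne
  rw [this] at h
  exact h rfl

theorem IsDil.of_inverse {f g : P → P} (hf : S.IsDil f) (hfg : Function.RightInverse g f) :
    S.IsDil g := by
  intro m hm x hx y hy
  by_cases hxy : x = y
  · subst hxy
    obtain ⟨k, hk, hc, h⟩ := exists_parallel (S := S) (g x) hm
    exact ⟨k, hk, h, hc, hc⟩
  obtain ⟨k, hk, h1, h2⟩ := exists_line (S := S) (g x) (g y)
  obtain ⟨n, hn, hnk, h3, h4⟩ := hf k hk _ h1 _ h2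
  rw [hfg] at h3 h4
  exact ⟨k, hk, line_unique hm hn hxy hx hy h3 h4 ▸ hnk.symm, h1, h2⟩

/-! ### Central and parallel pencils -/

/-- `L x` is the line through `x` of a pencil of lines that are parallel or pass through a common
vertex, where `D x` says that `x` is not the vertex; Desargues' axiom holds for the pencil. -/
structure IsPencil (S : AffinePlane P) (L : P → Set P) (D : P → Prop) : Prop where
  mem_lines : ∀ x, D x → L x ∈ S.lines
  mem : ∀ x, D x → x ∈ L x
  eq_of_mem : ∀ x y, D x → D y → y ∈ L x → L y = L x
  vertex_mem : ∀ x z, D x → ¬ D z → z ∈ L x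
  vertex_unique : ∀ z w, ¬ D z → ¬ D w → z = w
  desargues : ∀ A A' B B' C C', D A → D A' → D B → D B' → D C → D C' →
    L A = L A' → L B = L B' → L C = L C' → L A ≠ L B → L B ≠ L C → L A ≠ L C →
    Parallel (S.join A B) (S.join A' B') → Parallel (S.join B C) (S.join B' C') →
    Parallel (S.join A C) (S.join A' C')

/-- `p, x` and `p', x'` are on different lines of the pencil and in perspective. -/
structure Persp (S : AffinePlane P) (L : P → Set P) (D : P → Prop) (p p' x x' : P) : Prop where
  d1 : D p
  d1' : D p'
  d2 : D x
  d2' : D x'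
  l1 : L p = L p'
  l2 : L x = L x'
  ne : L p ≠ L x
  par : Parallel (S.join p x) (S.join p' x')

variable {L : P → Set P} {D : P → Prop} {p p' x x' : P}

theorem Persp.symm (h : S.Persp L D p p' x x') : S.Persp L D x x' p p' :=
  ⟨h.d2, h.d2', h.d1, h.d1', h.l2, h.l1, h.ne.symm, by
    rw [join_comm x p, join_comm x' p']; exact h.par⟩

theorem Persp.pt_ne (h : S.Persp L D p p' x x') : p ≠ x := fun e => h.ne (by rw [e])

theorem Persp.pt_ne' (h : S.Persp L D p p' x x') : p' ≠ x' :=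
  fun e => h.ne (by rw [h.l1, h.l2, e])

/-- This is Desargues' axiom for the pencil, applied to the triangles `r p s` and `r' p' s'`. -/
theorem Persp.trans (hL : S.IsPencil L D) {r r' s s' : P} (h : S.Persp L D p p' r r')
    (h' : S.Persp L D p p' s s') (hrs : L r ≠ L s) : S.Persp L D r r' s s' :=
  ⟨h.d2, h.d2', h'.d2, h'.d2', h.l2, h'.l2, hrs,
    hL.desargues r r' p p' s s' h.d2 h.d2' h.d1 h.d1' h'.d2 h'.d2' h.l2 h.l1 h'.l2 h.ne.symm h'.ne
      hrs h.symm.par h'.par⟩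

theorem IsPencil.exists_persp (hL : S.IsPencil L D) (hp : D p) (hp' : D p') (hpp : L p = L p')
    (hx : D x) (hne : L p ≠ L x) : ∃ x', S.Persp L D p p' x x' := by
  have hpx : p ≠ x := fun e => hne (by rw [e])
  have hj := join_mem_lines (S := S) hpx
  obtain ⟨k, hk, hpk, hkj⟩ := exists_parallel (S := S) p' hj
  have hnp : ¬ Parallel k (L x) := by
    intro h
    have := ((hkj.symm.trans hj hk (hL.mem_lines x hx) h)).eq_of_mem
      (right_mem_join hpx) (hL.mem x hx)
    exact hne (hL.eq_of_mem x p hx hp (this ▸ left_mem_join hpx))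
  obtain ⟨x', hx'k, hx'x⟩ := exists_mem_of_not_parallel hnp
  have hpx' : p' ≠ x' := by
    rintro rfl
    exact hne (hpp.trans (hL.eq_of_mem x p' hx hp' hx'x))
  -- Were `x'` the vertex, the parallel to `px` through `p'` would be the pencil line of `p`, and
  -- then so would `px`, although `x` lies on another pencil line.
  have hx' : D x' := by
    by_contra hD
    have h1 := hL.vertex_mem p' x' hp' hD
    have h2 : k = L p := hpp ▸ line_unique hk (hL.mem_lines p' hp') hpx' hpk hx'k (hL.mem p' hp') h1
    have h3 := (h2 ▸ hkj).eq_of_mem (hL.mem p hp) (left_mem_join hpx)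
    exact hne (hL.eq_of_mem p x hp hx (h3 ▸ right_mem_join hpx)).symm
  refine ⟨x', hp, hp', hx, hx', hpp, (hL.eq_of_mem x x' hx hx' hx'x).symm, hne, ?_⟩
  rw [join_eq hk hpx' hpk hx'k]
  exact hkj.symm

theorem Persp.unique (hL : S.IsPencil L D) {x'' : P} (h : S.Persp L D p p' x x')
    (h' : S.Persp L D p p' x x'') : x' = x'' := by
  by_contra hne
  have hj := join_mem_lines (S := S) h.pt_ne
  have e := parallel_unique (join_mem_lines h.pt_ne') (join_mem_lines h'.pt_ne') hj
    (left_mem_join h.pt_ne') (left_mem_join h'.pt_ne') h.par.symm h'.par.symm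
  have h1 : x' ∈ L x := h.l2 ▸ hL.mem x' h.d2'
  have h2 : x'' ∈ L x := h'.l2 ▸ hL.mem x'' h'.d2'
  have := line_unique (join_mem_lines h.pt_ne') (hL.mem_lines x h.d2) hne (right_mem_join h.pt_ne')
    (e ▸ right_mem_join h'.pt_ne') h1 h2
  exact h.ne (h.l1.trans (hL.eq_of_mem x p' h.d2 h.d1' (this ▸ left_mem_join h.pt_ne')))

theorem Persp.ne_of_ne (hL : S.IsPencil L D) (h : S.Persp L D p p' x x') (hpp : p ≠ p') :
    x ≠ x' := by
  rintro rfl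
  have e := h.par.eq_of_mem (right_mem_join h.pt_ne) (right_mem_join h.pt_ne')
  have := line_unique (join_mem_lines h.pt_ne) (hL.mem_lines p h.d1) hpp (left_mem_join h.pt_ne)
    (e ▸ left_mem_join h.pt_ne') (hL.mem p h.d1) (h.l1 ▸ hL.mem p' h.d1')
  exact h.ne (hL.eq_of_mem p x h.d1 h.d2 (this ▸ right_mem_join h.pt_ne)).symm

theorem IsPencil.eq_of_mem_join (hL : S.IsPencil L D) {y z : P} (hx : D x) (hxy : x ≠ y)
    (hy : D y) (hne : L x ≠ L y) (hz : z ∈ L x) (hzj : z ∈ S.join x y) : z = x := by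
  by_contra h
  have := line_unique (join_mem_lines hxy) (hL.mem_lines x hx) h hzj (left_mem_join hxy) hz
    (hL.mem x hx)
  exact hne (hL.eq_of_mem x y hx hy (this ▸ right_mem_join hxy)).symm

/-- Desargues' axiom needs three lines, but a pencil may have only two, as a parallel class in the
plane with four points. Then a common point of `xs` and `x's'` would lie on one of these two lines,
forcing `x = x'` or `s = s'`. -/
theorem Persp.trans_of_two_lines (hL : S.IsPencil L D) {r r' s s' : P}
    (h : S.Persp L D r r' x x') (hrs : L r = L s) (hs : D s) (hs' : D s') (hss : L s = L s')
    (hne : x ≠ x') (hne' : s ≠ s') (htwo : ∀ z, D z → L z = L x ∨ L z = L s) :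
    S.Persp L D x x' s s' := by
  have hxs : L x ≠ L s := hrs ▸ h.ne.symm
  have hxs' : L x' ≠ L s' := h.l2 ▸ hss ▸ hxs
  have n1 : x ≠ s := fun e => hxs (by rw [e])
  have n2 : x' ≠ s' := fun e => hxs' (by rw [e])
  refine ⟨h.d2, h.d2', hs, hs', h.l2, hss, hxs, Or.inr ?_⟩
  refine Set.eq_empty_iff_forall_notMem.2 ?_
  rintro z ⟨hz, hz'⟩
  have key1 : z ∈ L x → False := fun hzx => hne <|
    (hL.eq_of_mem_join h.d2 n1 hs hxs hzx hz).symm.trans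
      (hL.eq_of_mem_join h.d2' n2 hs' hxs' (h.l2 ▸ hzx) hz')
  have key2 : z ∈ L s → False := fun hzs => by
    rw [join_comm] at hz hz'
    exact hne' <| (hL.eq_of_mem_join hs n1.symm h.d2 hxs.symm hzs hz).symm.trans
      (hL.eq_of_mem_join hs' n2.symm h.d2' hxs'.symm (hss ▸ hzs) hz')
  by_cases hD : D z
  · rcases htwo z hD with e | e
    · exact key1 (e ▸ hL.mem z hD)
    · exact key2 (e ▸ hL.mem z hD)
  · exact key1 (hL.vertex_mem x z h.d2 hD)

/-- The central dilatation of a Desarguesian pencil that maps `p` to `p'`. -/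
theorem IsPencil.exists_isDil (hL : S.IsPencil L D) (hp : D p) (hp' : D p') (hpp : L p = L p')
    (hne : p ≠ p') : ∃ f : P → P, S.IsDil f ∧ f p = p' ∧ (∀ z, ¬ D z → f z = z) ∧
      (∀ x, D x → f x ≠ x) := by
  obtain ⟨r, hr⟩ := exists_notMem (hL.mem_lines p hp)
  have hrD : D r := by
    by_contra h
    exact hr (hL.vertex_mem p r hp h)
  have hpr : L p ≠ L r := fun h => hr (h ▸ hL.mem r hrD)
  obtain ⟨r', hrr⟩ := hL.exists_persp hp hp' hpp hrD hpr
  -- Points off the line of `p` are moved by perspectivity from `p, p'`; those on it need the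
  -- auxiliary pair `r, r'` on another line.
  have hf : ∀ x, ∃ x', (¬ D x → x' = x) ∧ (D x → L p ≠ L x → S.Persp L D p p' x x') ∧
      (D x → L p = L x → S.Persp L D r r' x x') := by
    intro x
    by_cases hx : D x
    · by_cases hpx : L p = L x
      · obtain ⟨x', h⟩ := hL.exists_persp hrD hrr.d2' hrr.l2 hx (hpx ▸ hpr.symm)
        exact ⟨x', by simp [hx], by simp [hpx], fun _ _ => h⟩
      · obtain ⟨x', h⟩ := hL.exists_persp hp hp' hpp hx hpx
        exact ⟨x', by simp [hx], fun _ _ => h, by simp [hpx]⟩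
    · exact ⟨x, by simp, by simp [hx], by simp [hx]⟩
  choose f f1 f2 f3 using hf
  have hrne := hrr.ne_of_ne hL hne
  have hmv : ∀ x, D x → x ≠ f x := by
    intro x hx
    by_cases hpx : L p = L x
    · exact (f3 x hx hpx).ne_of_ne hL hrne
    · exact (f2 x hx hpx).ne_of_ne hL hne
  have hD : ∀ x, D x → D (f x) ∧ L x = L (f x) := by
    intro x hx
    by_cases hpx : L p = L x
    · exact ⟨(f3 x hx hpx).d2', (f3 x hx hpx).l2⟩
    · exact ⟨(f2 x hx hpx).d2', (f2 x hx hpx).l2⟩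
  have claim : ∀ x y, D x → D y → L p = L x → L p ≠ L y → S.Persp L D x (f x) y (f y) := by
    intro x y hx hy hpx hpy
    have hxr := f3 x hx hpx
    -- If `y` is on the line of `r`, the comparison passes through a point `s` on a third line, when
    -- there is one.
    by_cases hyr : L r = L y
    · by_cases hs : ∃ s, D s ∧ L p ≠ L s ∧ L r ≠ L s
      · obtain ⟨s, hs, hps, hrs⟩ := hs
        have h1 := f2 s hs hps
        have h2 := hrr.trans hL h1 hrs
        have h3 := h2.trans hL hxr (hpx ▸ hps.symm)
        have h4 := h1.trans hL (f2 y hy hpy) (hyr ▸ hrs.symm)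
        exact h3.trans hL h4 (hpx ▸ hpy)
      · push Not at hs
        refine hxr.trans_of_two_lines hL hyr hy (hD y hy).1 (hD y hy).2 (hmv x hx) (hmv y hy) ?_
        intro z hz
        by_cases hpz : L p = L z
        · exact Or.inl (hpz.symm.trans hpx)
        · exact Or.inr ((hs z hz hpz).symm.trans hyr)
    · exact hxr.trans hL (hrr.trans hL (f2 y hy hpy) hyr) (hpx ▸ hpy)
  have claim' : ∀ x y, D x → D y → L x ≠ L y → S.Persp L D x (f x) y (f y) := by
    intro x y hx hy hxy
    by_cases hpx : L p = L x
    · exact claim x y hx hy hpx (hpx ▸ hxy)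
    · by_cases hpy : L p = L y
      · exact (claim y x hy hx hpy hpx).symm
      · exact (f2 x hx hpx).trans hL (f2 y hy hpy) hxy
  refine ⟨f, ?_, (f3 p hp rfl).unique hL hrr.symm, f1, fun x hx => (hmv x hx).symm⟩
  -- The vertex is fixed, and a line joining it to another point belongs to the pencil, each of
  -- whose lines is preserved.
  have hvert : ∀ m ∈ S.lines, ∀ x ∈ m, ∀ y ∈ m, x ≠ y → ¬ D x →
      ∃ m' ∈ S.lines, Parallel m' m ∧ f x ∈ m' ∧ f y ∈ m' := by
    intro m hm x hx y hy hxy hDx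
    have hDy : D y := by
      by_contra h
      exact hxy (hL.vertex_unique x y hDx h)
    refine ⟨m, hm, Parallel.refl m, (f1 x hDx).symm ▸ hx, ?_⟩
    rw [line_unique hm (hL.mem_lines y hDy) hxy hx hy (hL.vertex_mem y x hDy hDx) (hL.mem y hDy),
      (hD y hDy).2]
    exact hL.mem _ (hD y hDy).1
  intro m hm x hx y hy
  by_cases hxy : x = y
  · subst hxy
    obtain ⟨k, hk, hc, h⟩ := exists_parallel (S := S) (f x) hm
    exact ⟨k, hk, h, hc, hc⟩
  by_cases hDx : D x
  · by_cases hDy : D y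
    · by_cases hLxy : L x = L y
      · have e := line_unique hm (hL.mem_lines x hDx) hxy hx hy (hL.mem x hDx)
          (hLxy ▸ hL.mem y hDy)
        refine ⟨m, hm, Parallel.refl m, ?_, ?_⟩
        · rw [e, (hD x hDx).2]; exact hL.mem _ (hD x hDx).1
        · rw [e, hLxy, (hD y hDy).2]; exact hL.mem _ (hD y hDy).1
      · have h := claim' x y hDx hDy hLxy
        exact ⟨_, join_mem_lines h.pt_ne', join_eq hm hxy hx hy ▸ h.par.symm,
          left_mem_join h.pt_ne', right_mem_join h.pt_ne'⟩
    · obtain ⟨m', h1, h2, h3, h4⟩ := hvert m hm y hy x hx (Ne.symm hxy) hDy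
      exact ⟨m', h1, h2, h4, h3⟩
  · exact hvert m hm x hx y hy hxy hDx

theorem IsDesargues.isPencil_parallel (hS : S.IsDesargues) {k : Set P} (hk : k ∈ S.lines) :
    S.IsPencil (fun x => S.parallelThrough x k) (fun _ => True) := by
  have spec : ∀ x, S.parallelThrough x k ∈ S.lines ∧ x ∈ S.parallelThrough x k ∧
      Parallel (S.parallelThrough x k) k := by
    intro x
    obtain ⟨m, hm, hx, h⟩ := exists_parallel (S := S) x hk
    rw [parallelThrough_eq hm hk hx h]
    exact ⟨hm, hx, h⟩
  have par : ∀ x y, Parallel (S.parallelThrough x k) (S.parallelThrough y k) := fun x y =>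
    (spec x).2.2.trans (spec x).1 hk (spec y).1 (spec y).2.2.symm
  refine ⟨fun x _ => (spec x).1, fun x _ => (spec x).2.1, fun x y _ _ h => ?_, by simp, by simp, ?_⟩
  · exact parallelThrough_eq (spec x).1 hk h (spec x).2.2
  · intro A A' B B' C C' _ _ _ _ _ _ hA hB hC hAB hBC hAC
    exact hS _ (spec A).1 _ (spec B).1 _ (spec C).1 hAB hBC hAC A (spec A).2.1 A' (hA ▸ (spec A').2.1)
      B (spec B).2.1 B' (hB ▸ (spec B').2.1) C (spec C).2.1 C' (hC ▸ (spec C').2.1)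
      (Or.inl ⟨par _ _, par _ _, par _ _⟩)

theorem IsDesargues.isPencil_central (hS : S.IsDesargues) (Z : P) :
    S.IsPencil (fun x => S.join Z x) (fun x => x ≠ Z) := by
  refine ⟨fun x hx => join_mem_lines hx.symm, fun x hx => right_mem_join hx.symm,
    fun x y hx hy h => join_eq (join_mem_lines hx.symm) hy.symm (left_mem_join hx.symm) h, ?_, ?_, ?_⟩
  · intro x z hx hz
    rw [not_not.1 hz]
    exact left_mem_join hx.symm
  · intro z w hz hw
    rw [not_not.1 hz, not_not.1 hw]
  · intro A A' B B' C C' a a' b b' c c' hA hB hC hAB hBC hAC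
    exact hS _ (join_mem_lines a.symm) _ (join_mem_lines b.symm) _ (join_mem_lines c.symm) hAB hBC hAC
      A (right_mem_join a.symm) A' (by rw [hA]; exact right_mem_join a'.symm)
      B (right_mem_join b.symm) B' (by rw [hB]; exact right_mem_join b'.symm)
      C (right_mem_join c.symm) C' (by rw [hC]; exact right_mem_join c'.symm)
      (Or.inr ⟨Z, left_mem_join a.symm, left_mem_join b.symm, left_mem_join c.symm,
        a, a', b, b', c, c'⟩)

/-! ### Translations -/

/-- A translation is a dilatation that is the identity or has no fixed points. -/
def IsTrans (S : AffinePlane P) (f : P → P) : Prop :=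
  S.IsDil f ∧ (f = id ∨ ∀ x, f x ≠ x)

theorem isTrans_id : S.IsTrans id := ⟨isDil_id, Or.inl rfl⟩

theorem IsDesargues.exists_isTrans (hS : S.IsDesargues) (p q : P) :
    ∃ f, S.IsTrans f ∧ f p = q := by
  by_cases hpq : p = q
  · exact ⟨id, isTrans_id, hpq⟩
  have hk := join_mem_lines (S := S) hpq
  have e1 := parallelThrough_eq hk hk (left_mem_join hpq) (Parallel.refl _)
  have e2 := parallelThrough_eq hk hk (right_mem_join hpq) (Parallel.refl _)
  obtain ⟨f, hf, hfp, -, hfx⟩ := (hS.isPencil_parallel hk).exists_isDil (p := p) (p' := q)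
    trivial trivial (e1.trans e2.symm) hpq
  exact ⟨f, ⟨hf, Or.inr fun x => hfx x trivial⟩, hfp⟩

/-- The lines `x, f x` of a translation without fixed points are all parallel: at a common point
`z`, two of them would both contain `z` and `f z ≠ z`. -/
theorem IsTrans.trace {f : P → P} (hf : S.IsTrans f) {m : Set P} (hm : m ∈ S.lines) {p x : P}
    (hp : p ∈ m) (hfp : f p ∈ m) {k : Set P} (hk : k ∈ S.lines) (hkm : Parallel k m) (hx : x ∈ k) :
    f x ∈ k := by
  rcases hf.2 with rfl | hne
  · exact hx
  obtain ⟨n, hn, hxn, hfx⟩ := exists_line (S := S) x (f x)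
  by_cases hnm : Parallel n m
  · rwa [parallel_unique hk hn hm hx hxn hkm hnm]
  obtain ⟨z, hzn, hzm⟩ := exists_mem_of_not_parallel hnm
  have h1 := hf.1.mem hn hn (Parallel.refl n) hxn hzn hfx
  have h2 := hf.1.mem hm hm (Parallel.refl m) hp hzm hfp
  exact absurd (Or.inl (line_unique hn hm (hne z) h1 hzn h2 hzm)) hnm

/-- For `q` off the trace of `p`, the image of `q` is the fourth vertex of the parallelogram on `p`,
`f p` and `q`. Two values determine a dilatation. -/
theorem IsTrans.unique {f g : P → P} (hf : S.IsTrans f) (hg : S.IsTrans g) {p : P}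
    (h : f p = g p) : f = g := by
  obtain ⟨m, hm, hp, hfp⟩ := exists_line (S := S) p (f p)
  obtain ⟨q, hq⟩ := exists_notMem hm
  refine hf.1.eq hg.1 h ?_ (q := q) (by rintro rfl; exact hq hp)
  obtain ⟨k, hk, hqk, hkm⟩ := exists_parallel (S := S) q hm
  have h1 := hf.trace hm hp hfp hk hkm hqk
  have h2 := hg.trace hm hp (h ▸ hfp) hk hkm hqk
  obtain ⟨n, hn, hpn, hqn⟩ := exists_line (S := S) p q
  obtain ⟨n', hn', hnn, h3, h4⟩ := hf.1 n hn p hpn q hqn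
  have h5 := hg.1.mem hn hn' hnn hpn hqn (h ▸ h3)
  by_contra hne
  have := line_unique hk hn' hne h1 h2 h4 h5
  subst this
  have e := (hnn.symm.trans hn hk hm hkm).eq_of_mem hpn hp
  exact hq (e ▸ hqn)

theorem IsDil.exists_inverse [Finite P] {f : P → P} (hf : S.IsDil f) {p q : P} (h : f p ≠ f q) :
    ∃ g, S.IsDil g ∧ Function.LeftInverse g f ∧ Function.RightInverse g f := by
  obtain ⟨g, h1, h2⟩ := Function.bijective_iff_has_inverse.1
    (Finite.injective_iff_bijective.1 (hf.injective h))
  exact ⟨g, hf.of_inverse h2, h1, h2⟩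

theorem exists_ne' (S : AffinePlane P) (p : P) : ∃ q, p ≠ q := by
  obtain ⟨m, hm, hp, -⟩ := exists_line (S := S) p p
  obtain ⟨q, hq⟩ := exists_notMem hm
  exact ⟨q, by rintro rfl; exact hq hp⟩

theorem IsTrans.exists_ne {f : P → P} (hf : S.IsTrans f) (p : P) : ∃ q, f p ≠ f q := by
  obtain ⟨q, hq⟩ := S.exists_ne' p
  rcases hf.2 with rfl | h
  · exact ⟨q, hq⟩
  · exact ⟨f p, (h _).symm⟩

theorem IsTrans.conj {f g h : P → P} (hf : S.IsTrans f) (hg : S.IsDil g) (hh : S.IsDil h)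
    (hgh : Function.LeftInverse g h) (hhg : Function.RightInverse g h) :
    S.IsTrans (h ∘ f ∘ g) := by
  refine ⟨hh.comp (hf.1.comp hg), ?_⟩
  rcases hf.2 with rfl | hne
  · exact Or.inl (funext hhg)
  · refine Or.inr fun x hx => hne (g x) ?_
    rw [← hgh (f (g x))]
    exact congrArg g hx

/-- If `f ∘ g` fixes `x`, then `f` and the inverse of `g` are translations that agree at `g x`,
hence everywhere. -/
theorem IsTrans.comp [Finite P] {f g : P → P} (hf : S.IsTrans f)
    (hg : S.IsTrans g) : S.IsTrans (f ∘ g) := by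
  refine ⟨hf.1.comp hg.1, or_iff_not_imp_right.2 fun h => ?_⟩
  push Not at h
  obtain ⟨x, hx⟩ := h
  obtain ⟨q, hq⟩ := hg.exists_ne x
  obtain ⟨i, hi, h1, h2⟩ := hg.1.exists_inverse hq
  have hiT : S.IsTrans i := by
    refine ⟨hi, ?_⟩
    rcases hg.2 with rfl | hne
    · exact Or.inl (funext h1)
    · exact Or.inr fun y hy => hne (i y) (by rw [h2]; exact hy.symm)
  have : f = i := hf.unique hiT (p := g x) (by rw [h1]; exact hx)
  rw [this]
  exact funext h1

/-- The points of a finite Desarguesian affine plane form an abelian group with any given zero,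
such that the group translations are the translations of the plane. -/
theorem IsDesargues.exists_addCommGroup [Finite P] (hS : S.IsDesargues) (O : P) :
    ∃ _ : AddCommGroup P, (0 : P) = O ∧ (∀ v : P, S.IsTrans (fun x => v + x)) ∧
      ∀ f, S.IsTrans f → ∀ x, f x = f 0 + x := by
  -- `τ v` is the translation taking `O` to `v`, and the sum `x + y` will be `τ x y`.
  choose τ hτ hτO using hS.exists_isTrans O
  have key : ∀ f, S.IsTrans f → f = τ (f O) := fun f hf => hf.unique (hτ _) (hτO _).symm
  have comp : ∀ x y, τ x ∘ τ y = τ (τ x y) := by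
    intro x y
    have := key _ ((hτ x).comp (hτ y))
    rwa [Function.comp_apply, hτO] at this
  have hO : τ O = id := (key id isTrans_id).symm
  have hinv : ∀ x, ∃ y, τ y x = O := by
    intro x
    obtain ⟨f, hf, hfx⟩ := hS.exists_isTrans x O
    exact ⟨f O, by rw [← key f hf, hfx]⟩
  choose ν hν using hinv
  let _ : Add P := ⟨fun x y => τ x y⟩
  let _ : Zero P := ⟨O⟩
  let _ : Neg P := ⟨ν⟩
  let G : AddGroup P := AddGroup.ofLeftAxioms
    (fun x y z => by
      change τ (τ x y) z = τ x (τ y z)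
      rw [← comp]; rfl)
    (fun x => by
      change τ O x = x
      rw [hO]; rfl)
    (fun x => hν x)
  have hadd : ∀ x y : P, x + y = τ x y := fun _ _ => rfl
  -- Parallelogram: `x + w` and `w + x` both lie on the parallel to `Ow` through `x` and on the
  -- parallel to `Ox` through `w`.
  have comm1 : ∀ k ∈ S.lines, O ∈ k → ∀ x ∈ k, ∀ w, w ∉ k → x + w = w + x := by
    intro k hk hOk x hx w hw
    obtain ⟨m, hm, hOm, hwm⟩ := exists_line (S := S) O w
    obtain ⟨a, ha, hxa, ham⟩ := exists_parallel (S := S) x hm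
    obtain ⟨b, hb, hwb, hbk⟩ := exists_parallel (S := S) w hk
    have h1 := (hτ x).trace hk hOk ((hτO x).symm ▸ hx) hb hbk hwb
    have h2 := (hτ w).trace hm hOm ((hτO w).symm ▸ hwm) ha ham hxa
    have h3 := (hτ x).1.mem hm ha ham hOm hwm ((hτO x).symm ▸ hxa)
    have h4 := (hτ w).1.mem hk hb hbk hOk hx ((hτO w).symm ▸ hwb)
    by_contra hne
    have := line_unique ha hb hne h3 h2 h1 h4
    subst this
    have e := (ham.symm.trans hm ha hk hbk).eq_of_mem hOm hOk
    exact hw (e ▸ hwm)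
  have comm : ∀ x y : P, x + y = y + x := by
    intro x y
    obtain ⟨k, hk, hOk, hxk⟩ := exists_line (S := S) O x
    by_cases hy : y ∈ k
    -- For `y` collinear with `O` and `x`, both `z` and `y + z` are off that line and commute with
    -- `x`; cancelling `z` leaves the claim.
    · obtain ⟨z, hz⟩ := exists_notMem hk
      have hyz : y + z ∉ k := by
        intro h
        obtain ⟨n, hn, hzn, hnk⟩ := exists_parallel (S := S) z hk
        have h1 := (hτ y).trace hk hOk ((hτO y).symm ▸ hy) hn hnk hzn
        exact hz (hnk.eq_of_mem h1 h ▸ hzn)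
      have h := comm1 k hk hOk x hxk (y + z) hyz
      rw [add_assoc y z x, ← comm1 k hk hOk x hxk z hz, ← add_assoc, ← add_assoc] at h
      exact add_right_cancel h
    · exact comm1 k hk hOk x hxk y hy
  let C : AddCommGroup P := { G with add_comm := comm }
  refine ⟨C, rfl, hτ, fun f hf x => ?_⟩
  exact congrFun (key f hf) x

theorem IsDesargues.exists_homothety (hS : S.IsDesargues) {O x y : P} {m : Set P}
    (hm : m ∈ S.lines) (hO : O ∈ m) (hx : x ∈ m) (hy : y ∈ m) (hxO : x ≠ O) (hyO : y ≠ O) :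
    ∃ f, S.IsDil f ∧ f O = O ∧ f x = y := by
  by_cases hxy : x = y
  · exact ⟨id, isDil_id, rfl, hxy⟩
  have e1 := join_eq hm hxO.symm hO hx
  have e2 := join_eq hm hyO.symm hO hy
  obtain ⟨f, hf, hfx, hfO, -⟩ := (hS.isPencil_central O).exists_isDil hxO hyO (e1.trans e2.symm) hxy
  exact ⟨f, hf, hfO O (by simp), hfx⟩

/-! ### Vector space structure -/

/-- The line `p + K v` in a vector space. -/
def affLine (K : Type*) {V : Type*} [Field K] [AddCommGroup V] [Module K V] (p v : V) : Set V :=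
  {q | ∃ t : K, q = p + t • v}

/-- The lines of the plane `S` are the one-dimensional affine subspaces over `K`. -/
def IsVectorPlane (K : Type*) {V : Type*} [Field K] [AddCommGroup V] [Module K V]
    (S : AffinePlane V) : Prop :=
  ∀ m : Set V, m ∈ S.lines ↔ ∃ p v : V, v ≠ 0 ∧ m = affLine K p v

section scalars

variable [AddCommGroup P]

/-- The endomorphisms of the group of points that map each line through `0` into itself. -/
def scalars (S : AffinePlane P) : Subring (AddMonoid.End P) where
  carrier := {α | ∀ A : AddSubgroup P, (A : Set P) ∈ S.lines → ∀ x ∈ A, α x ∈ A}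
  mul_mem' := fun ha hb A hA x hx => ha A hA _ (hb A hA x hx)
  one_mem' := fun _ _ _ hx => hx
  add_mem' := fun ha hb A hA x hx => A.add_mem (ha A hA x hx) (hb A hA x hx)
  zero_mem' := fun A _ _ _ => A.zero_mem
  neg_mem' := fun ha A hA x hx => A.neg_mem (ha A hA x hx)

theorem exists_addSubgroup (hT : ∀ v : P, S.IsTrans (fun x => v + x)) {m : Set P}
    (hm : m ∈ S.lines) (h0 : (0 : P) ∈ m) : ∃ A : AddSubgroup P, (A : Set P) = m := by
  refine ⟨⟨⟨⟨m, ?_⟩, h0⟩, ?_⟩, rfl⟩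
  · intro x y hx hy
    exact (hT x).1.mem hm hm (Parallel.refl m) h0 hy (by simpa using hx)
  · intro x hx
    have := (hT (-x)).1.mem hm hm (Parallel.refl m) hx h0 (by simpa using h0)
    simpa using this

/-- If `α v = 0` and `w` is off the line `0v`, then `α w = α (v + w)` lies on the two distinct lines
`0w` and `0(v + w)`, so it is zero. Points on `0v` follow by repeating this from a point off it. -/
theorem eq_zero_of_mem_scalars (hT : ∀ v : P, S.IsTrans (fun x => v + x)) {α : AddMonoid.End P}
    (hα : α ∈ S.scalars) {v : P} (hv : v ≠ 0) (h : α v = 0) : α = 0 := by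
  have key : ∀ v : P, α v = 0 → ∀ A : AddSubgroup P, (A : Set P) ∈ S.lines → v ≠ 0 → v ∈ A →
      ∀ w, w ∉ A → α w = 0 := by
    intro v h A hA hv hvA w hw
    have hw0 : w ≠ 0 := by rintro rfl; exact hw A.zero_mem
    have hvw0 : v + w ≠ 0 := by
      intro e
      exact hw (by rw [eq_neg_of_add_eq_zero_right e]; exact A.neg_mem hvA)
    obtain ⟨B, hB⟩ := exists_addSubgroup hT (join_mem_lines (S := S) hw0.symm)
      (left_mem_join hw0.symm)
    obtain ⟨C, hC⟩ := exists_addSubgroup hT (join_mem_lines (S := S) hvw0.symm)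
      (left_mem_join hvw0.symm)
    have hBl : (B : Set P) ∈ S.lines := hB ▸ join_mem_lines hw0.symm
    have hCl : (C : Set P) ∈ S.lines := hC ▸ join_mem_lines hvw0.symm
    have hwB : w ∈ B := by rw [← SetLike.mem_coe, hB]; exact right_mem_join hw0.symm
    have hvwC : v + w ∈ C := by rw [← SetLike.mem_coe, hC]; exact right_mem_join hvw0.symm
    have h1 := hα B hBl w hwB
    have h2 := hα C hCl _ hvwC
    rw [map_add, h, zero_add] at h2
    by_contra hne
    have e := line_unique hBl hCl hne h1 B.zero_mem h2 C.zero_mem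
    have hvB : v ∈ B := by
      have : v + w ∈ B := by rw [← SetLike.mem_coe, e]; exact hvwC
      simpa using B.sub_mem this hwB
    have e' := line_unique hA hBl hv hvA A.zero_mem hvB B.zero_mem
    exact hw (by rw [← SetLike.mem_coe, e']; exact hwB)
  obtain ⟨A, hA⟩ := exists_addSubgroup hT (join_mem_lines (S := S) hv.symm) (left_mem_join hv.symm)
  have hAl : (A : Set P) ∈ S.lines := hA ▸ join_mem_lines hv.symm
  have hvA : v ∈ A := by rw [← SetLike.mem_coe, hA]; exact right_mem_join hv.symm
  ext w
  by_cases hw : w ∈ (A : Set P)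
  · by_cases hw0 : w = 0
    · simp [hw0]
    obtain ⟨z, hz⟩ := exists_notMem hAl
    have hz0 : z ≠ 0 := by rintro rfl; exact hz A.zero_mem
    obtain ⟨B, hB⟩ := exists_addSubgroup hT (join_mem_lines (S := S) hz0.symm)
      (left_mem_join hz0.symm)
    have hBl : (B : Set P) ∈ S.lines := hB ▸ join_mem_lines hz0.symm
    have hzB : z ∈ B := by rw [← SetLike.mem_coe, hB]; exact right_mem_join hz0.symm
    refine key z (key v h A hAl hv hvA z hz) B hBl hz0 hzB w fun hwB => hz ?_
    have e := line_unique hAl hBl hw0 hw A.zero_mem hwB B.zero_mem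
    rw [e]
    exact hzB
  · exact key v h A hAl hv hvA w hw

theorem exists_mem_scalars [Finite P] (hS : S.IsDesargues)
    (hT : ∀ v : P, S.IsTrans (fun x => v + x)) (hT' : ∀ f, S.IsTrans f → ∀ x, f x = f 0 + x)
    {m : Set P} (hm : m ∈ S.lines) (h0 : (0 : P) ∈ m) {x y : P} (hx : x ∈ m) (hy : y ∈ m)
    (hx0 : x ≠ 0) : ∃ α ∈ S.scalars, α x = y := by
  by_cases hy0 : y = 0
  · exact ⟨0, zero_mem _, hy0.symm⟩
  obtain ⟨f, hf, hf0, hfx⟩ := hS.exists_homothety hm h0 hx hy hx0 hy0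
  obtain ⟨g, hg, h1, h2⟩ := hf.exists_inverse (p := 0) (q := x)
    (by rw [hf0, hfx]; exact Ne.symm hy0)
  have hg0 : g 0 = 0 := by
    have := h1 0
    rwa [hf0] at this
  -- Conjugating the translation by `a` with `f` gives a translation taking `0` to `f a`; evaluating
  -- it at `f b` gives additivity.
  have hadd : ∀ a b, f (a + b) = f a + f b := by
    intro a b
    have := hT' _ ((hT a).conj hg hf h1 h2) (f b)
    simpa [h1 b, hg0] using this
  exact ⟨AddMonoidHom.mk' f hadd, fun A hA a ha => hf.mem hA hA (Parallel.refl _) A.zero_mem ha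
    (by rw [hf0]; exact A.zero_mem), hfx⟩

end scalars

/-- A finite Desarguesian affine plane is an affine plane over a field. -/
theorem IsDesargues.exists_isVectorPlane.{u} {P : Type u} {S : AffinePlane P} [Finite P]
    (hS : S.IsDesargues) (O : P) :
    ∃ (_ : AddCommGroup P) (K : Type u) (_ : Field K) (_ : Module K P), (0 : P) = O ∧
      S.IsVectorPlane K := by
  obtain ⟨G, hO, hT, hT'⟩ := hS.exists_addCommGroup O
  obtain ⟨e, he⟩ := S.exists_ne' 0
  have : Finite (AddMonoid.End P) := Finite.of_injective (fun f => (f : P → P)) DFunLike.coe_injective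
  have : Finite S.scalars := Subtype.finite
  have : Nontrivial S.scalars := by
    refine ⟨⟨0, 1, fun h => he ?_⟩⟩
    have := congrArg (fun α : S.scalars => (α : AddMonoid.End P) e) h
    exact this
  have : NoZeroDivisors S.scalars := by
    refine ⟨fun {a b} hab => or_iff_not_imp_right.2 fun hb => ?_⟩
    have : ∃ x, (b : AddMonoid.End P) x ≠ 0 := by
      by_contra! hc
      exact hb (Subtype.ext (AddMonoidHom.ext hc))
    obtain ⟨x, hx⟩ := this
    refine Subtype.ext (eq_zero_of_mem_scalars hT a.2 hx ?_)
    exact DFunLike.congr_fun (congrArg Subtype.val hab) x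
  have : IsDomain S.scalars := NoZeroDivisors.to_isDomain _
  -- Wedderburn's little theorem: the finite domain of scalars is commutative with inverses.
  let F : Field S.scalars := (Finite.isDomain_to_isField S.scalars).toField
  let M : Module S.scalars P := inferInstance
  have hline : ∀ v : P, v ≠ 0 → ∀ m ∈ S.lines, ∀ p ∈ m, p + v ∈ m →
      m = affLine S.scalars p v := by
    intro v hv m hm p hp hpv
    obtain ⟨k, hk, hkm, h0, hvk⟩ := (hT (-p)).1 m hm p hp _ hpv
    simp only [neg_add_cancel, neg_add_cancel_left] at h0 hvk
    obtain ⟨A, rfl⟩ := exists_addSubgroup hT hk h0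
    ext q
    constructor
    · intro hq
      have h1 := (hT (-p)).1.mem hm hk hkm hp hq (by simp [h0])
      obtain ⟨α, hα, h2⟩ := exists_mem_scalars hS hT hT' hk h0 hvk h1 hv
      refine ⟨⟨α, hα⟩, ?_⟩
      change q = p + α v
      rw [h2, add_neg_cancel_left]
    · rintro ⟨⟨α, hα⟩, rfl⟩
      have h1 : α v ∈ A := hα A hk v hvk
      exact (hT p).1.mem hk hm hkm.symm h0 h1 (by simpa using hp)
  refine ⟨G, S.scalars, F, M, hO, fun m => ⟨fun hm => ?_, ?_⟩⟩
  · obtain ⟨p, hp, q, hq, hpq⟩ := exists_ne_mem hm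
    exact ⟨p, q - p, sub_ne_zero.2 hpq.symm,
      hline _ (sub_ne_zero.2 hpq.symm) m hm p hp (by rwa [add_sub_cancel])⟩
  · rintro ⟨p, v, hv, rfl⟩
    have hne : p ≠ p + v := by simpa using hv
    have := hline v hv _ (join_mem_lines (S := S) hne) p (left_mem_join hne) (right_mem_join hne)
    exact this ▸ join_mem_lines hne

/-! ### Coordinates -/

section coordinates

variable {K V : Type*} [Field K] [AddCommGroup V] [Module K V] {S : AffinePlane V}

theorem IsVectorPlane.affLine_mem (h : S.IsVectorPlane K) (p : V) {v : V} (hv : v ≠ 0) :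
    affLine K p v ∈ S.lines := (h _).2 ⟨p, v, hv, rfl⟩

theorem self_mem_affLine (p v : V) : p ∈ affLine K p v := ⟨0, by simp⟩

theorem add_mem_affLine (p v : V) : p + v ∈ affLine K p v := ⟨1, by simp⟩

theorem affLine_parallel (p q v : V) : Parallel (affLine K p v) (affLine K q v) := by
  refine parallel_of_forall ?_
  rintro _ ⟨s, rfl⟩ ⟨t, h⟩
  have e : p = q + (t - s) • v := by
    rw [sub_smul, ← add_sub_assoc, ← h, add_sub_cancel_right]
  subst e
  ext r
  constructor
  · rintro ⟨c, rfl⟩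
    exact ⟨t - s + c, by rw [add_smul, add_assoc]⟩
  · rintro ⟨c, rfl⟩
    exact ⟨c - (t - s), by rw [add_assoc, ← add_smul]; congr 2; ring⟩

theorem IsVectorPlane.join_eq_affLine (h : S.IsVectorPlane K) {p q : V} (hpq : p ≠ q) :
    S.join p q = affLine K p (q - p) :=
  join_eq (h.affLine_mem p (sub_ne_zero.2 hpq.symm)) hpq (self_mem_affLine p _)
    (by simpa using add_mem_affLine (K := K) p (q - p))

theorem eq_zero_of_div {u v w a b d : K} (hd : d ≠ 0) (h : u * a + v * b + w * d = 0) :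
    u * (a / d) + v * (b / d) + w = 0 := by
  field_simp
  linear_combination h

/-- The set `m` has the equation `u x + v y + w = 0` in the coordinates `x, y`. -/
def HasEq (x y : V → K) (u v w : K) (m : Set V) : Prop :=
  (u ≠ 0 ∨ v ≠ 0) ∧ ∀ p, p ∈ m ↔ u * x p + v * y p + w = 0

/-- The functions `x, y` are affine coordinates of the plane `S`. -/
structure IsChart (S : AffinePlane V) (x y : V → K) : Prop where
  ext : ∀ p q, x p = x q → y p = y q → p = q
  surj : ∀ a b, ∃ p, x p = a ∧ y p = b
  exists_eq : ∀ m ∈ S.lines, ∃ u v w, HasEq x y u v w m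
  line : ∀ p q, p ≠ q →
    HasEq x y (y q - y p) (x p - x q) (x q * y p - x p * y q) (S.join p q)

theorem IsVectorPlane.exists_isChart (h : S.IsVectorPlane K) {O A B : V} (hOA : O ≠ A)
    (hB : B ∉ S.join O A) : ∃ x y : V → K, S.IsChart x y ∧
      x O = 0 ∧ y O = 0 ∧ x A = 1 ∧ y A = 0 ∧ x B = 0 ∧ y B = 1 := by
  have hOB : O ≠ B := by rintro rfl; exact hB (left_mem_join hOA)
  rw [h.join_eq_affLine hOA] at hB
  set e₁ := A - O with he₁
  set e₂ := B - O with he₂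
  have h1 : e₁ ≠ 0 := sub_ne_zero.2 hOA.symm
  have h2 : e₂ ≠ 0 := sub_ne_zero.2 hOB.symm
  have hBO : B = O + e₂ := by rw [he₂, add_sub_cancel]
  have hAO : A = O + e₁ := by rw [he₁, add_sub_cancel]
  have ind : ∀ s t : K, s • e₁ + t • e₂ = 0 → s = 0 ∧ t = 0 := by
    intro s t hst
    have ht : t = 0 := by
      by_contra ht
      refine hB ⟨-(t⁻¹ * s), ?_⟩
      have : e₂ = t⁻¹ • (t • e₂) := by rw [smul_smul, inv_mul_cancel₀ ht, one_smul]
      rw [hBO, this, eq_neg_of_add_eq_zero_right hst, smul_neg, smul_smul, neg_smul]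
    subst ht
    simpa [h1] using hst
  have span : ∀ q, ∃ s t : K, q = O + s • e₁ + t • e₂ := by
    intro q
    -- The parallel to `e₂` through `q` meets the line `OA`, which splits `q - O` along `e₁` and
    -- `e₂`.
    have hnp : ¬ Parallel (affLine K O e₁) (affLine K q e₂) := by
      intro hp
      have e := (hp.trans (h.affLine_mem O h1) (h.affLine_mem q h2) (h.affLine_mem O h2)
        (affLine_parallel q O e₂)).eq_of_mem (self_mem_affLine O e₁) (self_mem_affLine O e₂)
      rw [e, hBO] at hB
      exact hB (add_mem_affLine O e₂)
    obtain ⟨r, ⟨s, rfl⟩, ⟨t, ht⟩⟩ := exists_mem_of_not_parallel hnp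
    exact ⟨s, -t, by rw [ht, neg_smul]; abel⟩
  choose x y hxy using span
  have uniq : ∀ s t : K, x (O + s • e₁ + t • e₂) = s ∧ y (O + s • e₁ + t • e₂) = t := by
    intro s t
    have hq := hxy (O + s • e₁ + t • e₂)
    generalize x (O + s • e₁ + t • e₂) = X at hq
    generalize y (O + s • e₁ + t • e₂) = Y at hq
    have := ind (X - s) (Y - t) (by
      have : (X - s) • e₁ + (Y - t) • e₂ = (O + X • e₁ + Y • e₂) - (O + s • e₁ + t • e₂) := by
        module
      rw [this, ← hq, sub_self])
    exact ⟨sub_eq_zero.1 this.1, sub_eq_zero.1 this.2⟩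
  have ext : ∀ p q, x p = x q → y p = y q → p = q := by
    intro p q hx hy
    rw [hxy p, hxy q, hx, hy]
  have hadd : ∀ p (t a b : K), x (p + t • (a • e₁ + b • e₂)) = x p + t * a ∧
      y (p + t • (a • e₁ + b • e₂)) = y p + t * b := by
    intro p t a b
    have : p + t • (a • e₁ + b • e₂) = O + (x p + t * a) • e₁ + (y p + t * b) • e₂ := by
      conv_lhs => rw [hxy p]
      module
    rw [this]
    exact uniq _ _
  have heq : ∀ p v (a b : K), v = a • e₁ + b • e₂ → v ≠ 0 →
      HasEq x y b (-a) (a * y p - b * x p) (affLine K p v) := by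
    rintro p v a b rfl hv
    have hab : b ≠ 0 ∨ -a ≠ 0 := by
      by_contra! hc
      rw [hc.1, neg_eq_zero.1 hc.2] at hv
      simp at hv
    refine ⟨hab, fun q => ⟨?_, fun hq => ?_⟩⟩
    · rintro ⟨t, rfl⟩
      rw [(hadd p t a b).1, (hadd p t a b).2]
      ring
    · rcases hab with hb | ha
      · refine ⟨(y q - y p) / b, ext _ _ ?_ ?_⟩
        · rw [(hadd _ _ _ _).1]
          field_simp
          linear_combination hq
        · rw [(hadd _ _ _ _).2]
          field_simp
          ring
      · have ha : a ≠ 0 := neg_ne_zero.1 ha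
        refine ⟨(x q - x p) / a, ext _ _ ?_ ?_⟩
        · rw [(hadd _ _ _ _).1]
          field_simp
          ring
        · rw [(hadd _ _ _ _).2]
          field_simp
          linear_combination -hq
  have hO := uniq 0 0
  have hA := uniq 1 0
  have hB' := uniq 0 1
  simp only [zero_smul, one_smul, add_zero, ← hAO, ← hBO] at hO hA hB'
  refine ⟨x, y, ⟨ext, fun a b => ⟨_, uniq a b⟩, ?_, ?_⟩, hO.1, hO.2, hA.1, hA.2, hB'.1, hB'.2⟩
  · intro m hm
    obtain ⟨p, v, hv, rfl⟩ := (h m).1 hm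
    refine ⟨_, _, _, heq p v (x (O + v)) (y (O + v)) ?_ hv⟩
    have := hxy (O + v)
    rw [add_assoc] at this
    exact add_left_cancel this
  · intro p q hpq
    rw [h.join_eq_affLine hpq]
    have := heq p (q - p) (x q - x p) (y q - y p) (by
      conv_lhs => rw [hxy p, hxy q]
      module) (sub_ne_zero.2 hpq.symm)
    convert this using 1 <;> ring

theorem IsChart.parallel_iff {x y : V → K} (h : S.IsChart x y) {k m : Set V} {u v w u' v' w' : K}
    (hk : HasEq x y u v w k) (hm : HasEq x y u' v' w' m) : Parallel k m ↔ u * v' = u' * v := by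
  constructor
  · intro hp
    by_contra hne
    have hd : u * v' - u' * v ≠ 0 := sub_ne_zero.2 hne
    obtain ⟨p, hx, hy⟩ := h.surj ((v * w' - v' * w) / (u * v' - u' * v))
      ((u' * w - u * w') / (u * v' - u' * v))
    have e : k = m := hp.eq_of_mem (p := p)
      ((hk.2 p).2 (by rw [hx, hy]; exact eq_zero_of_div hd (by ring)))
      ((hm.2 p).2 (by rw [hx, hy]; exact eq_zero_of_div hd (by ring)))
    subst e
    have hpk := (hk.2 p).2 (by rw [hx, hy]; exact eq_zero_of_div hd (by ring))
    -- `(v, -u)` is a direction of `k`, so `q` is a further point of `k = m` and must satisfy the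
    -- equation of `m`.
    obtain ⟨q, hx', hy'⟩ := h.surj (x p + v) (y p - u)
    have h1 := (hk.2 p).1 hpk
    have h2 := (hm.2 p).1 hpk
    have h3 := (hm.2 q).1 ((hk.2 q).2 (by rw [hx', hy']; linear_combination h1))
    rw [hx', hy'] at h3
    exact hne (by linear_combination h2 - h3)
  · intro hd
    refine parallel_of_forall fun p hpk hpm => ?_
    have h1 := (hk.2 p).1 hpk
    have h2 := (hm.2 p).1 hpm
    ext q
    rw [hk.2, hm.2]
    constructor
    · intro hq
      rcases hk.1 with hu | hv
      · apply mul_left_cancel₀ hu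
        linear_combination u' * hq - u' * h1 + u * h2 + (y q - y p) * hd
      · apply mul_left_cancel₀ hv
        linear_combination v' * hq - v' * h1 + v * h2 - (x q - x p) * hd
    · intro hq
      rcases hm.1 with hu | hv
      · apply mul_left_cancel₀ hu
        linear_combination u * hq - u * h2 + u' * h1 - (y q - y p) * hd
      · apply mul_left_cancel₀ hv
        linear_combination v * hq - v * h2 + v' * h1 + (x q - x p) * hd

/-- The conclusions of Pappus' condition for the points `A, C, E` and `B, F, D`. -/
def PappusHolds (S : AffinePlane V) (A C E B F D : V) : Prop :=
  (∀ n ∈ S.lines,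
    (∃ N ∈ n, N ∈ S.join C B ∧ N ∈ S.join E F) →
    (∃ M ∈ n, M ∈ S.join A F ∧ M ∈ S.join C D) →
    (∃ L ∈ n, L ∈ S.join A B ∧ L ∈ S.join E D) ∨
      (Parallel (S.join A B) n ∧ Parallel (S.join E D) n)) ∧
  (Parallel (S.join C B) (S.join E F) → Parallel (S.join A F) (S.join C D) →
    Parallel (S.join A B) (S.join E D))

/-- In homogeneous coordinates, suitably scaled, the point `AB ∩ ED` is the sum of `CB ∩ EF` and `AF
∩ CD`, so it lies on every line through these two. If its weight `x D - x E - x B + x A` vanishes,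
it is at infinity and the lines are parallel to `n`. -/
theorem IsChart.pappusHolds_parallel {x y : V → K} (h : S.IsChart x y) {A C E B F D : V}
    (hA : y A = 0) (hC : y C = 0) (hE : y E = 0) (hB : y B = 1) (hF : y F = 1) (hD : y D = 1)
    (hAE : A ≠ E) : PappusHolds S A C E B F D := by
  have ne : ∀ p q, y p = 0 → y q = 1 → p ≠ q := by
    rintro p q hp hq rfl
    exact zero_ne_one (hp.symm.trans hq)
  have line : ∀ p q, y p = 0 → y q = 1 → HasEq x y 1 (x p - x q) (-x p) (S.join p q) := by
    intro p q hp hq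
    have := h.line p q (ne p q hp hq)
    rwa [hp, hq, sub_zero, mul_zero, zero_sub, mul_one] at this
  have hAE' : x A - x E ≠ 0 := sub_ne_zero.2 fun e => hAE (h.ext _ _ e (hA.trans hE.symm))
  have lCB := line C B hC hB
  have lEF := line E F hE hF
  have lAF := line A F hA hF
  have lCD := line C D hC hD
  have lAB := line A B hA hB
  have lED := line E D hE hD
  refine ⟨?_, ?_⟩
  · rintro n hn ⟨N, hNn, hN1, hN2⟩ ⟨M, hMn, hM1, hM2⟩
    obtain ⟨u, v, w, hnE⟩ := h.exists_eq n hn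
    rw [hnE.2] at hNn hMn
    rw [lCB.2] at hN1
    rw [lEF.2] at hN2
    rw [lAF.2] at hM1
    rw [lCD.2] at hM2
    have key : u * (x A * x D - x B * x E) + v * (x A - x E) +
        w * (x D - x E - x B + x A) = 0 := by
      linear_combination (x F - x E - x B + x C) * hNn + (x D - x C - x F + x A) * hMn
        + u * ((x E - x F) * hN1 - (x C - x B) * hN2) - v * (hN1 - hN2)
        + u * ((x C - x D) * hM1 - (x A - x F) * hM2) - v * (hM1 - hM2)
    by_cases hd : x D - x E - x B + x A = 0
    · right
      rw [h.parallel_iff lAB hnE, h.parallel_iff lED hnE]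
      have hxD : x D = x E + x B - x A := by linear_combination hd
      constructor
      · apply mul_left_cancel₀ hAE'
        rw [hxD] at key
        linear_combination key
      · apply mul_left_cancel₀ hAE'
        rw [hxD] at key ⊢
        linear_combination key
    · left
      obtain ⟨L, hx, hy⟩ := h.surj ((x A * x D - x B * x E) / (x D - x E - x B + x A))
        ((x A - x E) / (x D - x E - x B + x A))
      refine ⟨L, ?_, ?_, ?_⟩
      · rw [hnE.2, hx, hy]
        exact eq_zero_of_div hd key
      · rw [lAB.2, hx, hy]
        exact eq_zero_of_div hd (by ring)
      · rw [lED.2, hx, hy]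
        exact eq_zero_of_div hd (by ring)
  · intro h1 h2
    rw [h.parallel_iff lCB lEF] at h1
    rw [h.parallel_iff lAF lCD] at h2
    rw [h.parallel_iff lAB lED]
    linear_combination h1 + h2

/-- With `a, c, e` and `b, f, d` the coordinates on the two axes, the homogeneous vectors satisfy
`cf (AB ∩ ED) = ad (CB ∩ EF) + be (AF ∩ CD)`, and `cf ≠ 0`. The weight of `AB ∩ ED` is `be - ad`. In
the case of parallels, `be = cf` and `cf = ad` give `be = ad`. -/
theorem IsChart.pappusHolds_central {x y : V → K} (h : S.IsChart x y) {A C E B F D : V}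
    (hA : y A = 0) (hC : y C = 0) (hE : y E = 0) (hB : x B = 0) (hF : x F = 0) (hD : x D = 0)
    (hC0 : x C ≠ 0) (hB0 : y B ≠ 0) (hF0 : y F ≠ 0) (hD0 : y D ≠ 0)
    (hAE : A ≠ E) : PappusHolds S A C E B F D := by
  have ne : ∀ p q, y p = 0 → y q ≠ 0 → p ≠ q := by
    rintro p q hp hq rfl
    exact hq hp
  have line : ∀ p q, y p = 0 → x q = 0 → y q ≠ 0 →
      HasEq x y (y q) (x p) (-(x p * y q)) (S.join p q) := by
    intro p q hp hq hq'
    have := h.line p q (ne p q hp hq')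
    rwa [hp, hq, sub_zero, sub_zero, mul_zero, zero_sub] at this
  have hAE' : x A - x E ≠ 0 := sub_ne_zero.2 fun e => hAE (h.ext _ _ e (hA.trans hE.symm))
  have lCB := line C B hC hB hB0
  have lEF := line E F hE hF hF0
  have lAF := line A F hA hF hF0
  have lCD := line C D hC hD hD0
  have lAB := line A B hA hB hB0
  have lED := line E D hE hD hD0
  generalize x A = a at *
  generalize x C = c at *
  generalize x E = e at *
  generalize y B = b at *
  generalize y F = f at *
  generalize y D = d at *
  refine ⟨?_, ?_⟩
  · rintro n hn ⟨N, hNn, hN1, hN2⟩ ⟨M, hMn, hM1, hM2⟩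
    obtain ⟨u, v, w, hnE⟩ := h.exists_eq n hn
    rw [hnE.2] at hNn hMn
    rw [lCB.2] at hN1
    rw [lEF.2] at hN2
    rw [lAF.2] at hM1
    rw [lCD.2] at hM2
    have eN : u * (c * e * (b - f)) + v * (b * f * (e - c)) + w * (b * e - c * f) = 0 := by
      linear_combination (b * e - c * f) * hNn - u * (e * hN1 - c * hN2) - v * (b * hN2 - f * hN1)
    have eM : u * (a * c * (f - d)) + v * (d * f * (c - a)) + w * (c * f - a * d) = 0 := by
      linear_combination (c * f - a * d) * hMn - u * (c * hM1 - a * hM2) - v * (f * hM2 - d * hM1)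
    have key : u * (a * e * (b - d)) + v * (b * d * (e - a)) + w * (b * e - a * d) = 0 := by
      apply mul_left_cancel₀ (mul_ne_zero hC0 hF0)
      linear_combination a * d * eN + b * e * eM
    by_cases hd : b * e - a * d = 0
    · right
      rw [h.parallel_iff lAB hnE, h.parallel_iff lED hnE]
      constructor
      · apply mul_left_cancel₀ (mul_ne_zero hD0 hAE')
        linear_combination -key + w * hd + u * a * hd
      · apply mul_left_cancel₀ (mul_ne_zero hB0 hAE')
        linear_combination -key + w * hd + u * e * hd
    · left
      obtain ⟨L, hx, hy⟩ := h.surj ((a * e * (b - d)) / (b * e - a * d))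
        ((b * d * (e - a)) / (b * e - a * d))
      refine ⟨L, ?_, ?_, ?_⟩
      · rw [hnE.2, hx, hy]
        exact eq_zero_of_div hd key
      · rw [lAB.2, hx, hy]
        exact eq_zero_of_div hd (by ring)
      · rw [lED.2, hx, hy]
        exact eq_zero_of_div hd (by ring)
  · intro h1 h2
    rw [h.parallel_iff lCB lEF] at h1
    rw [h.parallel_iff lAF lCD] at h2
    rw [h.parallel_iff lAB lED]
    linear_combination h1 + h2

/-- An affine plane over a field satisfies Pappus' condition. -/
theorem IsVectorPlane.isPappian (h : S.IsVectorPlane K) : S.IsPappian := by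
  intro g hg k hk hgk A hA C hC E hE B hB F hF D hD hAk hCk hEk hBg hFg hDg hAC hAE _ _ _ _
  change PappusHolds S A C E B F D
  by_cases hp : Parallel g k
  · obtain ⟨x, y, hxy, hA1, hA2, hC1, hC2, hB1, hB2⟩ :=
      h.exists_isChart hAC (B := B) (by rwa [join_eq hg hAC hA hC])
    have eg := hxy.line A C hAC
    rw [join_eq hg hAC hA hC, hA1, hA2, hC1, hC2] at eg
    obtain ⟨u, v, w, ek⟩ := hxy.exists_eq k hk
    have hu := (hxy.parallel_iff eg ek).1 hp
    have hu0 : u = 0 := by linear_combination hu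
    have hv : v ≠ 0 := ek.1.resolve_left (not_not.2 hu0)
    have hBk := (ek.2 B).1 hB
    have onk : ∀ p ∈ k, y p = 1 := by
      intro p hp
      have := (ek.2 p).1 hp
      apply mul_left_cancel₀ hv
      rw [hu0, hB2] at hBk
      rw [hu0] at this
      linear_combination this - hBk
    have ong : ∀ p ∈ g, y p = 0 := by
      intro p hp
      linear_combination -(eg.2 p).1 hp
    exact hxy.pappusHolds_parallel (ong A hA) (ong C hC) (ong E hE) (onk B hB) (onk F hF) (onk D hD)
      hAE
  · obtain ⟨Z, hZg, hZk⟩ := exists_mem_of_not_parallel hp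
    have hZA : Z ≠ A := by rintro rfl; exact hAk hZk
    have hZB : Z ≠ B := by rintro rfl; exact hBg hZg
    -- The common point `Z` is the origin, and `g` and `k` are the axes.
    obtain ⟨x, y, hxy, hZ1, hZ2, hA1, hA2, hB1, hB2⟩ :=
      h.exists_isChart hZA (B := B) (by rwa [join_eq hg hZA hZg hA])
    have eg := hxy.line Z A hZA
    rw [join_eq hg hZA hZg hA, hZ1, hZ2, hA1, hA2] at eg
    have ek := hxy.line Z B hZB
    rw [join_eq hk hZB hZk hB, hZ1, hZ2, hB1, hB2] at ek
    have ong : ∀ p, p ∈ g ↔ y p = 0 := by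
      intro p
      rw [eg.2]
      constructor <;> intro h <;> linear_combination -h
    have onk : ∀ p, p ∈ k ↔ x p = 0 := by
      intro p
      rw [ek.2]
      constructor <;> intro h <;> linear_combination h
    simp only [ong, onk] at hA hC hE hB hF hD hAk hCk hEk hBg hFg hDg
    exact hxy.pappusHolds_central hA hC hE hB hF hD hCk hBg hFg hDg hAE

end coordinates

/-! ### The skew field over a line -/

theorem parallelThrough_inter_eq {P : Type*} {S : AffinePlane P} {k k' m : Set P}
    (hk : k ∈ S.lines) (hk' : k' ∈ S.lines) (hm : m ∈ S.lines) (hpar : Parallel k k')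
    (hne : k' ≠ m) {p q r : P} (hqk : q ∈ k') (hqm : q ∈ m) (hp : p ∈ k) (hrk : r ∈ k)
    (hrm : r ∈ m) : S.parallelThrough p k' ∩ m = {r} := by
  rw [parallelThrough_eq hk hk' hp hpar]
  refine Set.eq_singleton_iff_unique_mem.2 ⟨⟨hrk, hrm⟩, fun s hs => ?_⟩
  by_contra h
  have := line_unique hk hm h hs.1 hrk hs.2 hrm
  subst this
  exact hne (hpar.symm.eq_of_mem hqk hqm)

section

variable {K V : Type*} [Field K] [AddCommGroup V] [Module K V] {S : AffinePlane V}

theorem IsVectorPlane.eq_affLine (h : S.IsVectorPlane K) {l : Set V} (hl : l ∈ S.lines)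
    (h0 : (0 : V) ∈ l) {i : V} (hi : i ∈ l) (hi0 : i ≠ 0) : l = affLine K 0 i := by
  rw [← join_eq hl hi0.symm h0 hi, h.join_eq_affLine hi0.symm, sub_zero]

theorem IsVectorPlane.isPointSum (h : S.IsVectorPlane K) {l : Set V} (hl : l ∈ S.lines)
    (h0 : (0 : V) ∈ l) {i : V} (hi : i ∈ l) (hi0 : i ≠ 0) {B : V} (hB : B ∉ l) (a c : K) :
    S.IsPointSum l 0 B (a • i) (c • i) ((a + c) • i) := by
  have hl' := h.eq_affLine hl h0 hi hi0
  have hB0 : 0 ≠ B := by rintro rfl; exact hB h0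
  have hmem : ∀ t : K, t • i ∈ l := fun t => by rw [hl']; exact ⟨t, by simp⟩
  have hCB : c • i ≠ B := by rintro rfl; exact hB (hmem c)
  have hBi : affLine K B i ∈ S.lines := h.affLine_mem B hi0
  have hpar : Parallel (affLine K B i) l := hl' ▸ affLine_parallel B 0 i
  -- The fourth vertex of the parallelogram on `0`, `B`, `a • i`; subtracting `B - c • i` from it
  -- gives `(a + c) • i`.
  refine ⟨B + a • i, ?_, ?_⟩
  · rw [parallelThrough_eq hBi hl (self_mem_affLine B i) hpar, Set.inter_comm]
    refine parallelThrough_inter_eq (h.affLine_mem (a • i) hB0.symm) (join_mem_lines hB0) hBi ?_ ?_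
      (right_mem_join hB0) (self_mem_affLine B i) (self_mem_affLine _ _) ⟨1, ?_⟩ ⟨a, rfl⟩
    · rw [h.join_eq_affLine hB0, sub_zero]
      exact affLine_parallel _ _ _
    · intro e
      rw [← e] at hpar
      exact hB (hpar.eq_of_mem (left_mem_join hB0) h0 ▸ right_mem_join hB0)
    · rw [one_smul, add_comm]
  · refine parallelThrough_inter_eq (h.affLine_mem (B + a • i) (sub_ne_zero.2 hCB.symm))
      (join_mem_lines hCB) hl ?_ ?_ (left_mem_join hCB) (hmem c) (self_mem_affLine _ _)
      ⟨-1, ?_⟩ (hmem _)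
    · rw [h.join_eq_affLine hCB]
      exact affLine_parallel _ _ _
    · intro e
      exact hB (e ▸ right_mem_join hCB)
    · module

theorem IsVectorPlane.isPointProd (h : S.IsVectorPlane K) {l : Set V} (hl : l ∈ S.lines)
    (h0 : (0 : V) ∈ l) {i : V} (hi : i ∈ l) (hi0 : i ≠ 0) {B : V} (hB : B ∉ l) (a c : K) :
    S.IsPointProd l 0 i B (a • i) (c • i) ((a * c) • i) := by
  have hl' := h.eq_affLine hl h0 hi hi0
  have hB0 : 0 ≠ B := by rintro rfl; exact hB h0
  have hiB : i ≠ B := by rintro rfl; exact hB hi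
  have hmem : ∀ t : K, t • i ∈ l := fun t => by rw [hl']; exact ⟨t, by simp⟩
  have hCB : c • i ≠ B := by rintro rfl; exact hB (hmem c)
  -- The homothety with factor `a` takes `i` to `a • i`, hence `B` to the auxiliary point `a • B`
  -- and `c • i` to the product.
  refine ⟨a • B, ?_, ?_⟩
  · refine parallelThrough_inter_eq (h.affLine_mem (a • i) (sub_ne_zero.2 hiB.symm))
      (join_mem_lines hiB) (join_mem_lines hB0) ?_ ?_ (right_mem_join hiB) (right_mem_join hB0)
      (self_mem_affLine _ _) ⟨a, ?_⟩ ?_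
    · rw [h.join_eq_affLine hiB]
      exact affLine_parallel _ _ _
    · intro e
      have := line_unique (join_mem_lines hiB) hl hi0 (left_mem_join hiB) (e ▸ left_mem_join hB0)
        hi h0
      exact hB (this ▸ right_mem_join hiB)
    · module
    · rw [h.join_eq_affLine hB0]
      exact ⟨a, by simp⟩
  · rw [join_comm]
    refine parallelThrough_inter_eq (h.affLine_mem (a • B) (sub_ne_zero.2 hCB.symm))
      (join_mem_lines hCB) hl ?_ ?_ (left_mem_join hCB) (hmem c) (self_mem_affLine _ _)
      ⟨-a, ?_⟩ (hmem _)
    · rw [h.join_eq_affLine hCB]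
      exact affLine_parallel _ _ _
    · intro e
      exact hB (e ▸ right_mem_join hCB)
    · module

theorem IsVectorPlane.exists_isSkewFieldOver (h : S.IsVectorPlane K) {l : Set V} (hl : l ∈ S.lines)
    {O I : l} (hOI : O ≠ I) (hO : (0 : V) = O) : ∃ F : DivisionRing l, S.IsSkewFieldOver l O I F := by
  have h0 : (0 : V) ∈ l := hO ▸ O.2
  have hI0 : (I : V) ≠ 0 := fun e => hOI (Subtype.ext (hO.symm.trans e.symm))
  have hl' := Set.ext_iff.1 (h.eq_affLine hl h0 I.2 hI0)
  have hmem : ∀ t : K, t • (I : V) ∈ l := fun t => (hl' _).2 ⟨t, by simp⟩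
  let e : K ≃ l := Equiv.ofBijective (fun t => ⟨t • (I : V), hmem t⟩) (by
    constructor
    · intro s t hst
      exact smul_left_injective K hI0 (congrArg Subtype.val hst)
    · rintro ⟨p, hp⟩
      obtain ⟨t, rfl⟩ := (hl' p).1 hp
      exact ⟨t, Subtype.ext (by simp)⟩)
  have he : ∀ t, (e t : V) = t • (I : V) := fun _ => rfl
  refine ⟨e.symm.divisionRing, Subtype.ext ((he 0).trans (by rw [zero_smul, hO])),
    Subtype.ext ((he 1).trans (one_smul _ _)), fun A C B hB => ?_⟩
  obtain ⟨a, rfl⟩ := e.surjective A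
  obtain ⟨c, rfl⟩ := e.surjective C
  have hadd : (e.symm.divisionRing.add (e a) (e c) : l) = e (a + c) := by
    change e (e.symm (e a) + e.symm (e c)) = _
    rw [e.symm_apply_apply, e.symm_apply_apply]
  have hmul : (e.symm.divisionRing.mul (e a) (e c) : l) = e (a * c) := by
    change e (e.symm (e a) * e.symm (e c)) = _
    rw [e.symm_apply_apply, e.symm_apply_apply]
  rw [hadd, hmul, he, he, he, he, ← hO]
  exact ⟨h.isPointSum hl h0 I.2 hI0 hB a c, h.isPointProd hl h0 I.2 hI0 hB a c⟩

end

theorem coordPlane_isVectorPlane (K : Type*) [Field K] : (coordPlane K).IsVectorPlane K :=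
  fun _ => Iff.rfl

end AffinePlane

/-! ### Finite skew fields and the main theorem -/

theorem DivisionRing.isPappianSkewField_of_finite {F : Type*} [Finite F] (K : DivisionRing F) :
    IsPappianSkewField K := by
  -- Wedderburn's field structure extends `K`, so the coordinate plane is unchanged.
  let _ : Field F := littleWedderburn F
  exact (AffinePlane.coordPlane_isVectorPlane F).isPappian

theorem mainTheorem4 {P : Type*} [Finite P] (S : AffinePlane P) (hS : S.IsDesargues)
    (l : Set P) (hl : l ∈ S.lines)
    (btw : l → l → l → Prop) (hbtw : IsOrderedLine btw)
    (O I : l) (hOI : O ≠ I) :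
    (∃ K : DivisionRing l, S.IsSkewFieldOver l O I K) ∧
    (∀ K : DivisionRing l, S.IsSkewFieldOver l O I K →
      IsPappianSkewField K ∧ ∀ a b : l, K.mul a b = K.mul b a) ∧
    S.IsPappian := by
  obtain ⟨_, K, _, _, hO, h⟩ := hS.exists_isVectorPlane O
  refine ⟨h.exists_isSkewFieldOver hl hOI hO, fun F _ => ⟨F.isPappianSkewField_of_finite, ?_⟩,
    h.isPappian⟩
  exact (littleWedderburn l).mul_comm
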